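/- Conventions. All lattices have a least element $0$ and a greatest element $1$ (possibly $0=1$), and lattice homomorphisms preserve $0$ and $1$. A bitopological space $(S,\mathcal T^+,\mathcal T^-)$ is a set with two topologies; put $\mathcal L^{\pm}=\{U\in\mathcal T^{\pm}: S\setminus U\in\mathcal T^{\mp}\}$. A non-empty bitopological space is an abstract spectrum if $\mathcal L^+$ is a base of $\mathcal T^+$ and $\mathcal L^-$ is a base of $\mathcal T^-$; every $\mathcal T^+$-closed set is $\mathcal T^-$-compact and every $\mathcal T^-$-closed set is $\mathcal T^+$-compact; and at least one of $\mathcal T^+,\mathcal T^-$ is $T_0$. An $\mathbf S$-morphism is a map that is continuous for both the $\mathcal T^+$ and the $\mathcal T^-$ topologies; an $\mathbf S$-isomorphism is a bijective $\mathbf S$-morphism whose inverse is an $\mathbf S$-morphism (these two terms are also used for empty spaces). A family $S$ of subsets of a set $X$ is given the topology $\mathcal T^+$ with subbase $\{p\in S: x\notin p\}$, $x\in X$, and the topology $\mathcal T^-$ with subbase $\{p\in S: x\in p\}$, $x\in X$. For a distributive lattice $L$, $\operatorname{spec}(L)$ is the set of its (proper, non-empty) prime ideals with these two topologies ($\mathcal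 T^+$ is the Stone topology). Statement. Let $X$ be a set with two arbitrary (single-valued) binary operations $+,\times$ and two different points $\xi_0,\xi_1\in X$. A subset $p\subseteq X$ is an l-prime ideal if for all $x,y\in X$: $x+y\in p$ iff $x\in p$ and $y\in p$; and $x\times y\in p$ iff $x\in p$ or $y\in p$. It is proper if moreover $\xi_0\in p$ and $\xi_1\notin p$. Let $S$ be either the set of all l-prime ideals of $X$ or the set of all proper l-prime ideals of $X$. Then there are a distributive lattice $L$ with $0$ and $1$ and a function $\varphi:X\to L$ such that: (i) $\varphi(X)$ generates $L$ as a lattice with $0$ and $1$ (the only sublattice of $L$ containing $\varphi(X)$, $0$ and $1$ is $L$); (ii) $\varphi^{-1}(q)\in S$ for every $q\in\operatorname{spec}(L)$; (iii) $\Phi:\operatorname{spec}(L)\to S$, $q\mapsto\varphi^{-1}(q)$, is an $\mathbf S$-isomorphism, where $S$ and $\operatorname{spec}(L)$ are abstract spectra whenever $S\neq\emptyset$; (iv) if $L'$ is a distributive lattice with $0$ and $1$ and $\theta:X\to L'$ is a function such that $\theta^{-1}(q)\in S$ for every $q\in\operatorname{spec}(L')$ and $\Theta:\operatorname{spec}(L')\to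 S$, $q\mapsto\theta^{-1}(q)$, is an $\mathbf S$-morphism, then there is a unique lattice homomorphism $l:L\to L'$ with $l\circ\varphi=\theta$; (v) if $L_1$ is a distributive lattice with $0$ and $1$ and $\varphi_1:X\to L_1$ is a function such that $\varphi_1^{-1}(q)\in S$ for every $q\in\operatorname{spec}(L_1)$ and $\Phi_1:\operatorname{spec}(L_1)\to S$, $q\mapsto\varphi_1^{-1}(q)$, is an $\mathbf S$-isomorphism, then there is a unique lattice isomorphism $l:L\to L_1$ with $l\circ\varphi=\varphi_1$; (vi) $\varphi(a+b)=\varphi(a)\vee\varphi(b)$ and $\varphi(a\times b)=\varphi(a)\wedge\varphi(b)$ for all $a,b\in X$. -/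

import Mathlib

universe u v

namespace AbstractSpectra

open scoped Topology

/-- A bitopology on a set: an ordered pair of topologies `(𝒯⁺, 𝒯⁻)`. -/
structure Bitopology (S : Type*) where
  pos : TopologicalSpace S
  neg : TopologicalSpace S

/-- `ℒ⁺`: the `𝒯⁺`-open sets whose complement is `𝒯⁻`-open. -/
def Bitopology.posLattice {S : Type*} (B : Bitopology S) : Set (Set S) :=
  {U | IsOpen[B.pos] U ∧ IsOpen[B.neg] Uᶜ}

/-- `ℒ⁻`: the `𝒯⁻`-open sets whose complement is `𝒯⁺`-open. -/
def Bitopology.negLattice {S : Type*} (B : Bitopology S) : Set (Set S) :=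
  {U | IsOpen[B.neg] U ∧ IsOpen[B.pos] Uᶜ}

/-- Abstract spectra. -/
structure IsAbstractSpectrum {S : Type*} (B : Bitopology S) : Prop where
  nonempty : Nonempty S
  basis_pos : @TopologicalSpace.IsTopologicalBasis S B.pos B.posLattice
  basis_neg : @TopologicalSpace.IsTopologicalBasis S B.neg B.negLattice
  compact_neg : ∀ F : Set S, IsOpen[B.pos] Fᶜ → @IsCompact S B.neg F
  compact_pos : ∀ F : Set S, IsOpen[B.neg] Fᶜ → @IsCompact S B.pos F
  t0 : @T0Space S B.pos ∨ @T0Space S B.neg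

/-- Morphisms: maps continuous for the two first and for the two second topologies. -/
def IsSpectralMorphism {S T : Type*} (B : Bitopology S) (C : Bitopology T) (f : S → T) : Prop :=
  @Continuous S T B.pos C.pos f ∧ @Continuous S T B.neg C.neg f

/-- Isomorphisms: morphisms with a two-sided inverse that is a morphism. -/
def IsSpectralIso {S T : Type*} (B : Bitopology S) (C : Bitopology T) (f : S → T) : Prop :=
  IsSpectralMorphism B C f ∧
    ∃ g : T → S, IsSpectralMorphism C B g ∧ Function.LeftInverse g f ∧ Function.RightInverse g f

/-- The canonical bitopology of a family `S` of subsets of `X`: `𝒯⁺` has the subbase of all sets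
`{p ∈ S | x ∉ p}`, and `𝒯⁻` has the subbase of all sets `{p ∈ S | x ∈ p}`, for `x ∈ X`. -/
def familyBitopology {X : Type*} (S : Set (Set X)) : Bitopology S where
  pos := TopologicalSpace.generateFrom (Set.range fun x : X => {p : S | x ∉ (p : Set X)})
  neg := TopologicalSpace.generateFrom (Set.range fun x : X => {p : S | x ∈ (p : Set X)})

/-- `spec L`: the family of all prime ideals of `L`. As an abstract spectrum it carries
`familyBitopology (spec L)`; here `𝒯⁺` is the Stone topology. -/
def spec (L : Type*) [DistribLattice L] [BoundedOrder L] : Set (Set L) :=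
  {q | ∃ I : Order.Ideal L, I.IsPrime ∧ (I : Set L) = q}

/-- `S'(X)`: the family of all l-prime ideals of `(X, +, ×)`. -/
def lPrimeIdeals {X : Type*} (add mul : X → X → X) : Set (Set X) :=
  {p | (∀ x y, add x y ∈ p ↔ x ∈ p ∧ y ∈ p) ∧ (∀ x y, mul x y ∈ p ↔ x ∈ p ∨ y ∈ p)}

/-- `S'(X)_pr`: the family of all l-prime ideals that contain `ξ₀` and do not contain `ξ₁`. -/
def properLPrimeIdeals {X : Type*} (add mul : X → X → X) (ξ₀ ξ₁ : X) : Set (Set X) :=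
  {p | p ∈ lPrimeIdeals add mul ∧ ξ₀ ∈ p ∧ ξ₁ ∉ p}

/-- The map `spec L → S`, `q ↦ θ⁻¹(q)`. -/
def pullback {X L : Type*} [DistribLattice L] [BoundedOrder L] {S : Set (Set X)} (θ : X → L)
    (h : ∀ q ∈ spec L, θ ⁻¹' q ∈ S) (q : spec L) : S :=
  ⟨θ ⁻¹' (q : Set L), h q q.2⟩

/-- `A` generates `L` as a lattice with `0` and `1`: the only sublattice of `L` that contains
`A`, `0` and `1` is `L` itself. -/
def Generates {L : Type*} [DistribLattice L] [BoundedOrder L] (A : Set L) : Prop :=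
  ∀ M : Sublattice L, A ⊆ (M : Set L) → ⊥ ∈ M → ⊤ ∈ M → M = ⊤

end AbstractSpectra

open AbstractSpectra

/-!
An ultrafilter on the set of (proper) l-prime ideals converges pointwise to a (proper) l-prime
ideal, so `S` is compact in the patch topology generated by `𝒯⁺` and `𝒯⁻` together. By compactness
`ℒ⁺` of `S` is the bounded lattice of sets generated by the subbasic sets `{p | x ∉ p}`, and each of
its prime ideals consists of the members of `ℒ⁺` that miss one point of `S`. Hence `L = ℒ⁺` with
`φ x = {p | x ∉ p}` has spectrum `S`. By Stone duality every bounded distributive lattice `M` is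
`ℒ⁺` of its own spectrum, so for `θ : X → M` taking preimages under `q ↦ θ⁻¹(q)` is the required
homomorphism `L → M`.
-/

namespace AbstractSpectra

open Set TopologicalSpace
open scoped Topology

section Bitopology

variable {S T : Type*} {B : Bitopology S} {C : Bitopology T} {f : S → T} {g : T → S}

/-- The bitopology with the roles of `𝒯⁺` and `𝒯⁻` exchanged. It turns facts about `ℒ⁺` into facts
about `ℒ⁻`, which is `ℒ⁺` of the swapped bitopology. -/
def Bitopology.swap (B : Bitopology S) : Bitopology S := ⟨B.neg, B.pos⟩

/-- Compactness of the patch topology, the coarsest topology finer than both `𝒯⁺` and `𝒯⁻`. In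
Mathlib's order on topologies, where finer means smaller, this is the infimum. -/
def Bitopology.IsPatchCompact (B : Bitopology S) : Prop := @CompactSpace S (B.pos ⊓ B.neg)

/-- `ℒ⁺` as a bounded lattice of subsets of `S`. -/
def Bitopology.posSublattice (B : Bitopology S) : Sublattice (Set S) where
  carrier := B.posLattice
  supClosed' _ hU _ hV :=
    ⟨@IsOpen.union _ _ _ B.pos hU.1 hV.1,
      compl_sup (α := Set S) ▸ @IsOpen.inter _ B.neg _ _ hU.2 hV.2⟩
  infClosed' _ hU _ hV :=
    ⟨@IsOpen.inter _ B.pos _ _ hU.1 hV.1,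
      compl_inf (α := Set S) ▸ @IsOpen.union _ _ _ B.neg hU.2 hV.2⟩

theorem Bitopology.empty_mem_posSublattice (B : Bitopology S) : ∅ ∈ B.posSublattice :=
  ⟨@isOpen_empty S B.pos, compl_empty.symm ▸ @isOpen_univ S B.neg⟩

theorem Bitopology.univ_mem_posSublattice (B : Bitopology S) : univ ∈ B.posSublattice :=
  ⟨@isOpen_univ S B.pos, compl_univ.symm ▸ @isOpen_empty S B.neg⟩

instance : BoundedOrder B.posSublattice :=
  Subtype.boundedOrder B.empty_mem_posSublattice B.univ_mem_posSublattice

/-- A morphism acts contravariantly on the lattices `ℒ⁺`, by taking preimages. -/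
def IsSpectralMorphism.preimageHom (hf : IsSpectralMorphism B C f) :
    BoundedLatticeHom C.posSublattice B.posSublattice where
  toFun U := ⟨f ⁻¹' U, continuous_def.1 hf.1 _ U.2.1, continuous_def.1 hf.2 _ U.2.2⟩
  map_sup' _ _ := rfl
  map_inf' _ _ := rfl
  map_top' := rfl
  map_bot' := rfl

/-- Mutually inverse morphisms induce mutually inverse isomorphisms of the lattices `ℒ⁺`. -/
def IsSpectralMorphism.preimageIso (hf : IsSpectralMorphism B C f) (hg : IsSpectralMorphism C B g)
    (hgf : Function.LeftInverse g f) (hfg : Function.RightInverse g f) :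
    C.posSublattice ≃o B.posSublattice :=
  OrderIso.ofHomInv hf.preimageHom hg.preimageHom
    (OrderHom.ext _ _ <| funext fun U => Subtype.ext <| hgf.preimage_preimage U)
    (OrderHom.ext _ _ <| funext fun U => Subtype.ext <| hfg.preimage_preimage U)

theorem Bitopology.IsPatchCompact.swap (hB : B.IsPatchCompact) : B.swap.IsPatchCompact := by
  rwa [Bitopology.IsPatchCompact, Bitopology.swap, inf_comm]

theorem Bitopology.IsPatchCompact.isCompact_pos (hB : B.IsPatchCompact) {F : Set S}
    (hF : IsOpen[B.neg] Fᶜ) : @IsCompact S B.pos F := by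
  have hF_patch : IsClosed[B.pos ⊓ B.neg] F := @IsClosed.mk S (_) F (inf_le_right (a := B.pos) _ hF)
  have hF_compact : @IsCompact S (B.pos ⊓ B.neg) F :=
    @IsClosed.isCompact S (_) F hB hF_patch
  rw [← image_id F]
  exact @IsCompact.image S S (_) B.pos F id hF_compact (continuous_id_iff_le.2 inf_le_left)

theorem isTopologicalBasis_of_infClosed [t : TopologicalSpace S] {s C : Set (Set S)}
    (ht : t = generateFrom s) (hsC : s ⊆ C) (hopen : ∀ U ∈ C, IsOpen U) (huniv : univ ∈ C)
    (hinf : InfClosed C) : IsTopologicalBasis C :=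
  isTopologicalBasis_of_subbasis_of_finiteInter
    (le_antisymm (le_generateFrom hopen) (ht ▸ generateFrom_anti hsC))
    ⟨huniv, fun _ hU _ hV => hinf hU hV⟩

end Bitopology

section Spec

variable {L : Type*} [DistribLattice L] [BoundedOrder L]

theorem spec_eq_properLPrimeIdeals :
    spec L = properLPrimeIdeals (· ⊔ ·) (· ⊓ ·) (⊥ : L) ⊤ := by
  ext q
  constructor
  · rintro ⟨I, hI, rfl⟩
    exact ⟨⟨fun _ _ => I.sup_mem_iff, fun _ _ => ⟨hI.mem_or_mem, Or.rec (I.lower inf_le_left)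
      (I.lower inf_le_right)⟩⟩, I.bot_mem, hI.toIsProper.top_notMem⟩
  · rintro ⟨⟨hsup, hinf⟩, hbot, htop⟩
    let I : Order.Ideal L :=
      { carrier := q
        lower' := fun a b hba ha => ((hsup b a).1 (by simpa only [sup_eq_right.2 hba])).1
        nonempty' := ⟨⊥, hbot⟩
        directed' := fun a ha b hb => ⟨a ⊔ b, (hsup a b).2 ⟨ha, hb⟩, le_sup_left, le_sup_right⟩ }
    have : I.IsProper := Order.Ideal.isProper_of_notMem htop
    exact ⟨I, .of_mem_or_mem fun {x y} => (hinf x y).1, rfl⟩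

section Membership

variable {q : Set L} (hq : q ∈ spec L) {a b : L}
include hq

theorem sup_mem_spec : a ⊔ b ∈ q ↔ a ∈ q ∧ b ∈ q :=
  (spec_eq_properLPrimeIdeals.subset hq).1.1 a b

theorem inf_mem_spec : a ⊓ b ∈ q ↔ a ∈ q ∨ b ∈ q :=
  (spec_eq_properLPrimeIdeals.subset hq).1.2 a b

theorem bot_mem_spec : ⊥ ∈ q :=
  (spec_eq_properLPrimeIdeals.subset hq).2.1

theorem top_notMem_spec : ⊤ ∉ q :=
  (spec_eq_properLPrimeIdeals.subset hq).2.2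

theorem mem_spec_of_le (hab : a ≤ b) (hb : b ∈ q) : a ∈ q :=
  ((sup_mem_spec hq).1 (by rwa [sup_eq_right.2 hab])).1

end Membership

theorem le_of_forall_spec {a b : L} (h : ∀ q ∈ spec L, b ∈ q → a ∈ q) : a ≤ b := by
  by_contra hab
  have hdisj : Disjoint (Order.PFilter.principal a : Set L) (Order.Ideal.principal b : Set L) :=
    disjoint_left.2 fun c hac hcb => hab
      ((Order.PFilter.mem_principal.1 hac).trans (Order.Ideal.mem_principal.1 hcb))
  obtain ⟨J, hJ, hbJ, haJ⟩ := DistribLattice.prime_ideal_of_disjoint_filter_ideal hdisj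
  exact disjoint_left.1 haJ (Order.PFilter.mem_principal.2 le_rfl)
    (h J ⟨J, hJ, rfl⟩ (hbJ (Order.Ideal.mem_principal.2 le_rfl)))

theorem Generates.injective_comp {X : Type*} {φ : X → L} (hφ : Generates (range φ)) {M F : Type*}
    [DistribLattice M] [BoundedOrder M] [FunLike F L M] [BoundedLatticeHomClass F L M] :
    Function.Injective fun f : F => ⇑f ∘ φ := by
  intro f g hfg
  let E : Sublattice L :=
    { carrier := {a | f a = g a}
      supClosed' := fun a ha b hb => by rw [mem_ofPred_eq] at *; rw [map_sup, map_sup, ha, hb]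
      infClosed' := fun a ha b hb => by rw [mem_ofPred_eq] at *; rw [map_inf, map_inf, ha, hb] }
  have hE : E = ⊤ := hφ E (range_subset_iff.2 (congrFun hfg))
    ((map_bot f).trans (map_bot g).symm) ((map_top f).trans (map_top g).symm)
  exact DFunLike.ext f g fun a => (hE ▸ Sublattice.mem_top a : a ∈ E)

/-- The prime ideal of `ℒ⁺` formed by the sets that do not contain the point `p`. -/
def pointIdeal {S : Type*} (B : Bitopology S) (p : S) : Set B.posSublattice :=
  {U | p ∉ (U : Set S)}

theorem pointIdeal_mem_spec {S : Type*} (B : Bitopology S) (p : S) :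
    pointIdeal B p ∈ spec B.posSublattice :=
  spec_eq_properLPrimeIdeals.superset
    ⟨⟨fun _ _ => not_or, fun _ _ => not_and_or⟩, fun h => h, fun h => h trivial⟩

theorem Bitopology.IsPatchCompact.exists_eq_pointIdeal {S : Type*} {B : Bitopology S}
    (hB : B.IsPatchCompact) {q : Set B.posSublattice} (hq : q ∈ spec B.posSublattice) :
    ∃ p, q = pointIdeal B p := by
  let _ : TopologicalSpace S := B.pos ⊓ B.neg
  have : CompactSpace S := hB
  -- A point with ideal `q` is one lying in `V \ U` whenever `U ∈ q` and `V ∉ q`.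
  let K (UV : q × (qᶜ : Set B.posSublattice)) : Set S := (UV.2 : Set S) \ UV.1
  have hK_closed UV : IsClosed (K UV) := by
    have hV : IsClosed (UV.2 : Set S) := ⟨inf_le_right (a := B.pos) _ UV.2.1.2.2⟩
    have hU : IsOpen (UV.1 : Set S) := inf_le_left (b := B.neg) _ UV.1.1.2.1
    exact hV.sdiff hU
  have hK_nonempty UV : (K UV).Nonempty :=
    sdiff_nonempty.2 fun hVU => UV.2.2 (mem_spec_of_le hq (b := UV.1.1) hVU UV.1.2)
  have hK_directed : Directed (· ⊇ ·) K := by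
    rintro ⟨U₁, V₁⟩ ⟨U₂, V₂⟩
    refine ⟨⟨⟨U₁ ⊔ U₂, (sup_mem_spec hq).2 ⟨U₁.2, U₂.2⟩⟩,
      ⟨V₁ ⊓ V₂, (inf_mem_spec hq).not.2 (not_or.2 ⟨V₁.2, V₂.2⟩)⟩⟩, ?_, ?_⟩
    · exact sdiff_subset_sdiff inter_subset_left subset_union_left
    · exact sdiff_subset_sdiff inter_subset_right subset_union_right
  have : Nonempty (q × (qᶜ : Set B.posSublattice)) :=
    ⟨⟨⊥, bot_mem_spec hq⟩, ⟨⊤, top_notMem_spec hq⟩⟩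
  obtain ⟨p, hp⟩ := IsCompact.nonempty_iInter_of_directed_nonempty_isCompact_isClosed K hK_directed
    hK_nonempty (fun UV => (hK_closed UV).isCompact) hK_closed
  rw [mem_iInter] at hp
  refine ⟨p, Set.ext fun U => ⟨fun hU => (hp ⟨⟨U, hU⟩, ⟨⊤, top_notMem_spec hq⟩⟩).2, fun hpU => ?_⟩⟩
  by_contra hU
  exact hpU (hp ⟨⟨⊥, bot_mem_spec hq⟩, ⟨U, hU⟩⟩).1

end Spec

section Family

variable {X : Type*} {S : Set (Set X)}

/-- The subbasic `𝒯⁺`-open set of the members of `S` that do not contain `x`, as an element of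
`ℒ⁺`. -/
def basicOpen (S : Set (Set X)) (x : X) : (familyBitopology S).posSublattice where
  val := {p | x ∉ (p : Set X)}
  property := ⟨isOpen_generateFrom_of_mem ⟨x, rfl⟩,
    isOpen_generateFrom_of_mem ⟨x, Set.ext fun _ => not_not.symm⟩⟩

theorem setOf_mem_mem_negLattice (S : Set (Set X)) (x : X) :
    {p : S | x ∈ (p : Set X)} ∈ (familyBitopology S).negLattice :=
  ⟨isOpen_generateFrom_of_mem ⟨x, rfl⟩, (basicOpen S x).2.1⟩

theorem t0Space_familyBitopology_pos (S : Set (Set X)) : @T0Space S (familyBitopology S).pos := by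
  let _ := (familyBitopology S).pos
  exact ⟨fun p q hpq => Subtype.ext <| Set.ext fun x =>
    not_iff_not.1 (hpq.mem_open_iff (basicOpen S x).2.1)⟩

theorem isAbstractSpectrum_of_isPatchCompact (hS : (familyBitopology S).IsPatchCompact)
    (hne : S.Nonempty) : IsAbstractSpectrum (familyBitopology S) where
  nonempty := hne.to_subtype
  basis_pos := @isTopologicalBasis_of_infClosed S (familyBitopology S).pos _ _ rfl
    (range_subset_iff.2 fun x => (basicOpen S x).2) (fun _ hU => hU.1)
    (familyBitopology S).univ_mem_posSublattice (familyBitopology S).posSublattice.infClosed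
  basis_neg := @isTopologicalBasis_of_infClosed S (familyBitopology S).neg _ _ rfl
    (range_subset_iff.2 (setOf_mem_mem_negLattice S)) (fun _ hU => hU.1)
    (familyBitopology S).swap.univ_mem_posSublattice
    (familyBitopology S).swap.posSublattice.infClosed
  compact_neg _ := hS.swap.isCompact_pos
  compact_pos _ := hS.isCompact_pos
  t0 := .inl (t0Space_familyBitopology_pos S)

theorem generates_range_basicOpen (hS : (familyBitopology S).IsPatchCompact) :
    Generates (range (basicOpen S)) := by
  intro M hM hbot htop
  let _ := (familyBitopology S).pos
  let N : Sublattice (Set S) := M.map (Sublattice.subtype _)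
  have hN_basis : IsTopologicalBasis (N : Set (Set S)) :=
    isTopologicalBasis_of_infClosed rfl
      (range_subset_iff.2 fun x => ⟨basicOpen S x, hM ⟨x, rfl⟩, rfl⟩)
      (by rintro _ ⟨U, -, rfl⟩; exact U.2.1) ⟨⊤, htop, rfl⟩ N.infClosed
  refine eq_top_iff.2 fun U _ => ?_
  obtain ⟨s, hs, hUs⟩ := eq_finite_iUnion_of_isTopologicalBasis_of_isCompact_open
    ((↑) : N → Set S) (Subtype.range_coe.symm ▸ hN_basis) U (hS.isCompact_pos U.2.2) U.2.1
  have hUN : (U : Set S) ∈ N :=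
    hUs ▸ N.supClosed.biSup_mem hs ⟨⊥, hbot, rfl⟩ fun V _ => V.2
  obtain ⟨V, hVM, hVU⟩ := hUN
  exact Subtype.ext hVU ▸ hVM

theorem isSpectralMorphism_pullback {L : Type*} [DistribLattice L] [BoundedOrder L] (θ : X → L)
    (h : ∀ q ∈ spec L, θ ⁻¹' q ∈ S) :
    IsSpectralMorphism (familyBitopology (spec L)) (familyBitopology S) (pullback θ h) :=
  ⟨continuous_generateFrom_iff.2 <| forall_mem_range.2 fun x =>
      isOpen_generateFrom_of_mem ⟨θ x, rfl⟩,
    continuous_generateFrom_iff.2 <| forall_mem_range.2 fun x =>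
      isOpen_generateFrom_of_mem ⟨θ x, rfl⟩⟩

theorem preimage_basicOpen_pointIdeal (p : S) :
    basicOpen S ⁻¹' pointIdeal (familyBitopology S) p = p :=
  Set.ext fun _ => not_not

theorem isSpectralMorphism_pointIdeal {S : Type*} (B : Bitopology S) :
    IsSpectralMorphism B (familyBitopology (spec B.posSublattice))
      fun p => ⟨pointIdeal B p, pointIdeal_mem_spec B p⟩ := by
  refine ⟨continuous_generateFrom_iff.2 <| forall_mem_range.2 fun U => ?_,
    continuous_generateFrom_iff.2 <| forall_mem_range.2 fun U => U.2.2⟩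
  convert U.2.1 using 1
  exact Set.ext fun _ => not_not

theorem preimage_basicOpen_mem (hS : (familyBitopology S).IsPatchCompact) :
    ∀ q ∈ spec (familyBitopology S).posSublattice, basicOpen S ⁻¹' q ∈ S := by
  intro q hq
  obtain ⟨p, rfl⟩ := hS.exists_eq_pointIdeal hq
  exact (preimage_basicOpen_pointIdeal p).symm ▸ p.2

theorem isSpectralIso_pullback_basicOpen (hS : (familyBitopology S).IsPatchCompact) :
    IsSpectralIso (familyBitopology (spec (familyBitopology S).posSublattice)) (familyBitopology S)
      (pullback (basicOpen S) (preimage_basicOpen_mem hS)) := by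
  have hright : Function.RightInverse
      (fun p => (⟨pointIdeal _ p, pointIdeal_mem_spec _ p⟩ : spec _))
      (pullback (basicOpen S) (preimage_basicOpen_mem hS)) :=
    fun p => Subtype.ext (preimage_basicOpen_pointIdeal p)
  refine ⟨isSpectralMorphism_pullback _ _, _, isSpectralMorphism_pointIdeal _,
    ?_, hright⟩
  rintro ⟨q, hq⟩
  obtain ⟨p, rfl⟩ := hS.exists_eq_pointIdeal hq
  rw [show pullback _ _ _ = p from hright p]

/-- The limit of an ultrafilter `F` on a family of subsets of `X`, taken pointwise: a point belongs
to the limit when it belongs to `F`-almost every member of the family. -/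
def ultraLimit (F : Ultrafilter S) : Set X := {x | ∀ᶠ p : S in F, x ∈ (p : Set X)}

theorem isPatchCompact_of_ultraLimit_mem (hS : ∀ F : Ultrafilter S, ultraLimit F ∈ S) :
    (familyBitopology S).IsPatchCompact := by
  refine @CompactSpace.mk S (_) <| (@isCompact_iff_ultrafilter_le_nhds S (_) univ).2
    fun F _ => ⟨⟨ultraLimit F, hS F⟩, trivial, ?_⟩
  rw [nhds_inf, familyBitopology, nhds_generateFrom, nhds_generateFrom]
  refine le_inf (le_iInf₂ ?_) (le_iInf₂ ?_)
  · rintro _ ⟨hx, x, rfl⟩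
    exact Filter.le_principal_iff.2 (Ultrafilter.eventually_not.2 hx)
  · rintro _ ⟨hx, x, rfl⟩
    exact Filter.le_principal_iff.2 hx

theorem ultraLimit_mem_lPrimeIdeals {add mul : X → X → X} (hS : S ⊆ lPrimeIdeals add mul)
    (F : Ultrafilter S) : ultraLimit F ∈ lPrimeIdeals add mul := by
  refine ⟨fun x y => ?_, fun x y => ?_⟩
  · exact (Filter.eventually_congr (.of_forall fun p => (hS p.2).1 x y)).trans Filter.eventually_and
  · exact (Filter.eventually_congr (.of_forall fun p => (hS p.2).2 x y)).trans
      Ultrafilter.eventually_or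

theorem isPatchCompact_lPrimeIdeals (add mul : X → X → X) :
    (familyBitopology (lPrimeIdeals add mul)).IsPatchCompact :=
  isPatchCompact_of_ultraLimit_mem (ultraLimit_mem_lPrimeIdeals subset_rfl)

theorem properLPrimeIdeals_subset_lPrimeIdeals (add mul : X → X → X) (ξ₀ ξ₁ : X) :
    properLPrimeIdeals add mul ξ₀ ξ₁ ⊆ lPrimeIdeals add mul :=
  fun _ hp => hp.1

theorem isPatchCompact_properLPrimeIdeals (add mul : X → X → X) (ξ₀ ξ₁ : X) :
    (familyBitopology (properLPrimeIdeals add mul ξ₀ ξ₁)).IsPatchCompact :=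
  isPatchCompact_of_ultraLimit_mem fun F =>
    ⟨ultraLimit_mem_lPrimeIdeals (properLPrimeIdeals_subset_lPrimeIdeals add mul ξ₀ ξ₁) F,
      .of_forall fun p => p.2.2.1, Ultrafilter.eventually_not.1 (.of_forall fun p => p.2.2.2)⟩

theorem basicOpen_add {add mul : X → X → X} (hS : S ⊆ lPrimeIdeals add mul) (x y : X) :
    basicOpen S (add x y) = basicOpen S x ⊔ basicOpen S y :=
  Subtype.ext <| Set.ext fun p => ((hS p.2).1 x y).not.trans not_and_or

theorem basicOpen_mul {add mul : X → X → X} (hS : S ⊆ lPrimeIdeals add mul) (x y : X) :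
    basicOpen S (mul x y) = basicOpen S x ⊓ basicOpen S y :=
  Subtype.ext <| Set.ext fun p => ((hS p.2).2 x y).not.trans not_or

end Family

section Stone

variable {L : Type*} [DistribLattice L] [BoundedOrder L]

theorem isPatchCompact_spec (L : Type*) [DistribLattice L] [BoundedOrder L] :
    (familyBitopology (spec L)).IsPatchCompact :=
  spec_eq_properLPrimeIdeals (L := L) ▸ isPatchCompact_properLPrimeIdeals _ _ _ _

/-- Stone's representation of `L` by sets of prime ideals. -/
def stoneHom (L : Type*) [DistribLattice L] [BoundedOrder L] :
    BoundedLatticeHom L (familyBitopology (spec L)).posSublattice where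
  toFun := basicOpen (spec L)
  map_sup' _ _ := Subtype.ext <| Set.ext fun q => (sup_mem_spec q.2).not.trans not_and_or
  map_inf' _ _ := Subtype.ext <| Set.ext fun q => (inf_mem_spec q.2).not.trans not_or
  map_top' := Subtype.ext <| Set.ext fun q => iff_of_true (top_notMem_spec q.2) trivial
  map_bot' := Subtype.ext <| Set.ext fun q => iff_of_false (not_not.2 (bot_mem_spec q.2)) id

theorem stoneHom_le_stoneHom {a b : L} : stoneHom L a ≤ stoneHom L b ↔ a ≤ b :=
  ⟨fun h => le_of_forall_spec fun q hq => not_imp_not.1 (@h ⟨q, hq⟩),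
    fun h => OrderHomClass.mono _ h⟩

theorem stoneHom_surjective : Function.Surjective (stoneHom L) := by
  have hrange : Sublattice.LatticeHom.range (stoneHom L : LatticeHom L _) = ⊤ :=
    generates_range_basicOpen (isPatchCompact_spec L) _ subset_rfl
      ⟨⊥, map_bot (stoneHom L)⟩ ⟨⊤, map_top (stoneHom L)⟩
  exact fun U => hrange.ge (Sublattice.mem_top U)

/-- Stone duality for bounded distributive lattices: `L` is the lattice `ℒ⁺` of its spectrum. -/
noncomputable def stoneIso (L : Type*) [DistribLattice L] [BoundedOrder L] :
    L ≃o (familyBitopology (spec L)).posSublattice :=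
  RelIso.ofSurjective (OrderEmbedding.ofMapLEIff (stoneHom L) fun _ _ => stoneHom_le_stoneHom)
    stoneHom_surjective

variable {X : Type*} {S : Set (Set X)}

theorem stoneIso_symm_preimageHom_basicOpen (θ : X → L) (h : ∀ q ∈ spec L, θ ⁻¹' q ∈ S) (x : X) :
    (stoneIso L).symm ((isSpectralMorphism_pullback θ h).preimageHom (basicOpen S x)) = θ x :=
  (stoneIso L).symm_apply_apply (θ x)

theorem existsUnique_boundedLatticeHom_comp_basicOpen_eq
    (hS : (familyBitopology S).IsPatchCompact) (θ : X → L) (h : ∀ q ∈ spec L, θ ⁻¹' q ∈ S) :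
    ∃! l : BoundedLatticeHom (familyBitopology S).posSublattice L, ⇑l ∘ basicOpen S = θ := by
  let l := ((stoneIso L).symm : BoundedLatticeHom _ L).comp
    (isSpectralMorphism_pullback θ h).preimageHom
  have hl : ⇑l ∘ basicOpen S = θ := funext (stoneIso_symm_preimageHom_basicOpen θ h)
  exact ⟨l, hl, fun m hm => (generates_range_basicOpen hS).injective_comp (hm.trans hl.symm)⟩

theorem existsUnique_orderIso_comp_basicOpen_eq
    (hS : (familyBitopology S).IsPatchCompact) (θ : X → L) (h : ∀ q ∈ spec L, θ ⁻¹' q ∈ S)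
    (hθ : IsSpectralIso (familyBitopology (spec L)) (familyBitopology S) (pullback θ h)) :
    ∃! l : (familyBitopology S).posSublattice ≃o L, ⇑l ∘ basicOpen S = θ := by
  obtain ⟨hθ_mor, g, hg_mor, hleft, hright⟩ := hθ
  let l := (hθ_mor.preimageIso hg_mor hleft hright).trans (stoneIso L).symm
  have hl : ⇑l ∘ basicOpen S = θ := funext (stoneIso_symm_preimageHom_basicOpen θ h)
  exact ⟨l, hl, fun m hm => (generates_range_basicOpen hS).injective_comp (hm.trans hl.symm)⟩

end Stone

end AbstractSpectra

theorem corollary2p4p3_general {X : Type u} {S : Set (Set X)}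
    (hS : (familyBitopology S).IsPatchCompact) :
    ∃ (L : Type u) (_ : DistribLattice L) (_ : BoundedOrder L) (φ : X → L),
      (S.Nonempty → IsAbstractSpectrum (familyBitopology S) ∧
        IsAbstractSpectrum (familyBitopology (spec L))) ∧
      Generates (Set.range φ) ∧
      (∃ h : ∀ q ∈ spec L, φ ⁻¹' q ∈ S,
        IsSpectralIso (familyBitopology (spec L)) (familyBitopology S) (pullback φ h)) ∧
      (∀ (L' : Type v) [DistribLattice L'] [BoundedOrder L'] (θ : X → L'),
        (∀ q ∈ spec L', θ ⁻¹' q ∈ S) → ∃! l : BoundedLatticeHom L L', ⇑l ∘ φ = θ) ∧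
      (∀ (L₁ : Type v) [DistribLattice L₁] [BoundedOrder L₁] (φ₁ : X → L₁)
        (h : ∀ q ∈ spec L₁, φ₁ ⁻¹' q ∈ S),
        IsSpectralIso (familyBitopology (spec L₁)) (familyBitopology S) (pullback φ₁ h) →
        ∃! l : L ≃o L₁, ⇑l ∘ φ = φ₁) ∧
      (∀ add mul : X → X → X, S ⊆ lPrimeIdeals add mul →
        ∀ a b : X, φ (add a b) = φ a ⊔ φ b ∧ φ (mul a b) = φ a ⊓ φ b) := by
  refine ⟨(familyBitopology S).posSublattice, inferInstance, inferInstance, basicOpen S,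
    fun hne => ⟨isAbstractSpectrum_of_isPatchCompact hS hne, ?_⟩, generates_range_basicOpen hS,
    ⟨preimage_basicOpen_mem hS, isSpectralIso_pullback_basicOpen hS⟩,
    fun _ _ _ => existsUnique_boundedLatticeHom_comp_basicOpen_eq hS,
    fun _ _ _ => existsUnique_orderIso_comp_basicOpen_eq hS,
    fun _ _ hsub a b => ⟨basicOpen_add hsub a b, basicOpen_mul hsub a b⟩⟩
  obtain ⟨p, hp⟩ := hne
  exact isAbstractSpectrum_of_isPatchCompact (isPatchCompact_spec _)
    ⟨_, pointIdeal_mem_spec (familyBitopology S) ⟨p, hp⟩⟩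

theorem corollary2p4p3 {X : Type u} (add mul : X → X → X) (ξ₀ ξ₁ : X) (hξ : ξ₀ ≠ ξ₁)
    (S : Set (Set X))
    (hS : S = lPrimeIdeals add mul ∨ S = properLPrimeIdeals add mul ξ₀ ξ₁) :
    ∃ (L : Type u) (_ : DistribLattice L) (_ : BoundedOrder L) (φ : X → L),
      -- the two spaces below are objects of the category of abstract spectra (unless empty)
      (S.Nonempty → IsAbstractSpectrum (familyBitopology S) ∧
        IsAbstractSpectrum (familyBitopology (spec L))) ∧
      -- (i)
      Generates (Set.range φ) ∧
      -- (ii) and (iii)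
      (∃ h : ∀ q ∈ spec L, φ ⁻¹' q ∈ S,
        IsSpectralIso (familyBitopology (spec L)) (familyBitopology S) (pullback φ h)) ∧
      -- (iv)
      (∀ (L' : Type v) [DistribLattice L'] [BoundedOrder L'] (θ : X → L')
        (h : ∀ q ∈ spec L', θ ⁻¹' q ∈ S),
        IsSpectralMorphism (familyBitopology (spec L')) (familyBitopology S) (pullback θ h) →
        ∃! l : BoundedLatticeHom L L', ⇑l ∘ φ = θ) ∧
      -- (v)
      (∀ (L₁ : Type v) [DistribLattice L₁] [BoundedOrder L₁] (φ₁ : X → L₁)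
        (h : ∀ q ∈ spec L₁, φ₁ ⁻¹' q ∈ S),
        IsSpectralIso (familyBitopology (spec L₁)) (familyBitopology S) (pullback φ₁ h) →
        ∃! l : L ≃o L₁, ⇑l ∘ φ = φ₁) ∧
      -- (vi)
      (∀ a b : X, φ (add a b) = φ a ⊔ φ b ∧ φ (mul a b) = φ a ⊓ φ b) := by
  have hcpt : (familyBitopology S).IsPatchCompact :=
    hS.elim (· ▸ isPatchCompact_lPrimeIdeals add mul)
      (· ▸ isPatchCompact_properLPrimeIdeals add mul ξ₀ ξ₁)
  have hsub : S ⊆ lPrimeIdeals add mul :=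
    hS.elim (·.subset) (· ▸ properLPrimeIdeals_subset_lPrimeIdeals add mul ξ₀ ξ₁)
  obtain ⟨L, _, _, φ, hspec, hgen, hiso, hhom, hequiv, hop⟩ := corollary2p4p3_general hcpt
  exact ⟨L, _, _, φ, hspec, hgen, hiso, fun L' _ _ θ h _ => hhom L' θ h, hequiv, hop add mul hsub⟩
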